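/- Theorem 3.1. All manifolds are smooth, finite-dimensional and without boundary. Let $(\bar M,g,J)$ be a nearly Kaehler manifold, that is, an almost Hermitian manifold ($J$ is a smooth field of endomorphisms of the tangent spaces with $J^2=-I$ and $g(JX,JY)=g(X,Y)$) such that $(\bar\nabla_XJ)X=0$ for every vector field $X$, where $\bar\nabla$ is the Levi-Civita connection of $g$. Let $(N_\theta,g_1)$ and $(N_T,g_2)$ be Riemannian manifolds, with $N_\theta$ connected and $N_T$ non-empty of positive dimension, let $f$ be a positive smooth function on $N_\theta$, and let $M=N_\theta\times_fN_T$ be the warped product, i.e. $N_\theta\times N_T$ with the metric $\pi^*g_1+(f\circ\pi)^2\rho^*g_2$, where $\pi$ and $\rho$ are the projections to $N_\theta$ and $N_T$. Let $\varphi:M\to\bar M$ be an isometric immersion such that (a) for every $p\in N_\theta$ the submanifold $\varphi(\{p\}\times N_T)$ is holomorphic: $J$ maps each of its tangent spaces onto itself; (b) for every $q\in N_T$ the submanifold $\varphi(N_\theta\times\{q\})$ is proper slant: the angle between $JZ$ and the tangent space of this submanifold is the same for all nonzero tangent vectors $Z$ at all of its points, and the submanifold is neither holomorphic nor totally real (totally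 real: $J$ maps each tangent space into its orthogonal complement). Then $f$ is equal to a constant $c>0$, and $M$ is the Riemannian product of $(N_\theta,g_1)$ and $(N_T,c^2g_2)$. In other words, there are no warped product semi-slant submanifolds $N_\theta\times_fN_T$ of a nearly Kaehler manifold with non-constant $f$. -/

import Mathlib

open Bundle Manifold
open scoped ContDiff

noncomputable section

namespace NearlyKaehler

/-! Throughout, a Riemannian manifold is a smooth manifold whose tangent bundle carries a Riemannian
metric (`RiemannianBundle`) depending smoothly on the point (`IsContMDiffRiemannianBundle`); the
inner product of `v w : TangentSpace I x` is written `inner ℝ v w`. -/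

section Ambient

variable {E : Type*} [NormedAddCommGroup E] [NormedSpace ℝ E] [FiniteDimensional ℝ E]
  {H : Type*} [TopologicalSpace H] (I : ModelWithCorners ℝ E H)
  {M : Type*} [TopologicalSpace M] [ChartedSpace H M] [IsManifold I ∞ M]
  [RiemannianBundle (fun x : M ↦ TangentSpace I x)]
  [IsContMDiffRiemannianBundle I ∞ E (fun x : M ↦ TangentSpace I x)]

/-- The vector field `X` is differentiable at `x`, as a section of the tangent bundle. -/
def IsDifferentiableFieldAt (X : ∀ x : M, TangentSpace I x) (x : M) : Prop :=
  MDifferentiableAt I (I.prod 𝓘(ℝ, E)) (fun y ↦ (TotalSpace.mk' E y (X y) : TangentBundle I M)) x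

/-- `nabla` is the Levi-Civita connection: it is torsion free and metric, that is,
`v (g (Y, Z)) = g (∇_v Y, Z) + g (Y, ∇_v Z)`.
(In Mathlib, `nabla Y x v` is the derivative of the vector field `Y` at `x` in the direction `v`.) -/
structure IsLeviCivita
    (nabla : CovariantDerivative I E (fun x : M ↦ TangentSpace I x)) : Prop where
  torsion_eq_zero : nabla.torsion = 0
  metric : ∀ (Y Z : ∀ x : M, TangentSpace I x) (x : M),
    IsDifferentiableFieldAt I Y x → IsDifferentiableFieldAt I Z x → ∀ v : TangentSpace I x,
      mvfderiv I (fun y ↦ inner ℝ (Y y) (Z y)) x v =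
        inner ℝ (nabla Y x v) (Z x) + inner ℝ (Y x) (nabla Z x v)

/-- `(M, g, J)` is an almost Hermitian manifold: `J` is a smooth field of endomorphisms of the
tangent spaces with `J² = -id` and `g (J v, J w) = g (v, w)`. -/
structure IsAlmostHermitian (J : ∀ x : M, TangentSpace I x →L[ℝ] TangentSpace I x) : Prop where
  contMDiff : ContMDiff I (I.prod 𝓘(ℝ, E →L[ℝ] E)) ∞
    (fun x : M ↦ (TotalSpace.mk' (E →L[ℝ] E) x (J x) :
      TotalSpace (E →L[ℝ] E) (fun x : M ↦ TangentSpace I x →L[ℝ] TangentSpace I x)))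
  map_map : ∀ (x : M) (v : TangentSpace I x), J x (J x v) = -v
  inner_map_map : ∀ (x : M) (v w : TangentSpace I x), inner ℝ (J x v) (J x w) = inner ℝ v w

/-- The value at `x` of `(∇_X J) Y = ∇_X (J Y) - J (∇_X Y)`. -/
def covDerivEndo (nabla : CovariantDerivative I E (fun x : M ↦ TangentSpace I x))
    (J : ∀ x : M, TangentSpace I x →L[ℝ] TangentSpace I x)
    (X Y : ∀ x : M, TangentSpace I x) (x : M) : TangentSpace I x :=
  nabla (fun y ↦ J y (Y y)) x (X x) - J x (nabla Y x (X x))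

/-- `(M, g, J)` is a nearly Kaehler manifold: it is almost Hermitian and `(∇_X J) X = 0` for every
vector field `X`, where `∇` is the Levi-Civita connection of `g`. The identity is asked at every
point at which `X` is differentiable. -/
def IsNearlyKaehler (J : ∀ x : M, TangentSpace I x →L[ℝ] TangentSpace I x) : Prop :=
  IsAlmostHermitian I J ∧
    ∃ nabla : CovariantDerivative I E (fun x : M ↦ TangentSpace I x), IsLeviCivita I nabla ∧
      ∀ (X : ∀ x : M, TangentSpace I x) (x : M),
        IsDifferentiableFieldAt I X x → covDerivEndo I nabla J X X x = 0

end Ambient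

section Submanifold

variable {E' : Type*} [NormedAddCommGroup E'] [NormedSpace ℝ E'] [FiniteDimensional ℝ E']
  {H' : Type*} [TopologicalSpace H'] (I' : ModelWithCorners ℝ E' H')
  {N : Type*} [TopologicalSpace N] [ChartedSpace H' N]
  {E : Type*} [NormedAddCommGroup E] [NormedSpace ℝ E]
  {H : Type*} [TopologicalSpace H] (I : ModelWithCorners ℝ E H)
  {M : Type*} [TopologicalSpace M] [ChartedSpace H M]

/-- The tangent space at `p` of the submanifold `ι : N → M`, as a subspace of the tangent space of
the ambient manifold at `ι p`. -/
def imageTangentSpace (ι : N → M) (p : N) : Submodule ℝ (TangentSpace I (ι p)) :=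
  LinearMap.range (mfderiv I' I ι p : TangentSpace I' p →ₗ[ℝ] TangentSpace I (ι p))

instance (ι : N → M) (p : N) : FiniteDimensional ℝ (imageTangentSpace I' I ι p) :=
  haveI : FiniteDimensional ℝ (TangentSpace I' p) := inferInstanceAs (FiniteDimensional ℝ E')
  inferInstanceAs (FiniteDimensional ℝ
    (LinearMap.range (mfderiv I' I ι p : TangentSpace I' p →ₗ[ℝ] TangentSpace I (ι p))))

/-- The submanifold `ι : N → M` is holomorphic: `J (T_p N) = T_p N` for all `p`. -/
def IsHolomorphicSubmanifold (J : ∀ x : M, TangentSpace I x →L[ℝ] TangentSpace I x)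
    (ι : N → M) : Prop :=
  ∀ p : N, (imageTangentSpace I' I ι p).map
      (J (ι p) : TangentSpace I (ι p) →ₗ[ℝ] TangentSpace I (ι p)) = imageTangentSpace I' I ι p

variable [RiemannianBundle (fun x : M ↦ TangentSpace I x)]

/-- The submanifold `ι : N → M` is totally real: `J (T_p N)` is orthogonal to `T_p N` for all
`p`. -/
def IsTotallyRealSubmanifold (J : ∀ x : M, TangentSpace I x →L[ℝ] TangentSpace I x)
    (ι : N → M) : Prop :=
  ∀ p : N, ∀ v ∈ imageTangentSpace I' I ι p, J (ι p) v ∈ (imageTangentSpace I' I ι p)ᗮ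

/-- The Wirtinger angle of `v`: the angle between `J v` and the subspace `T_p N`, that is, the angle
between `J v` and its orthogonal projection to `T_p N` (it is `π / 2` if this projection is `0`). -/
def wirtingerAngle (J : ∀ x : M, TangentSpace I x →L[ℝ] TangentSpace I x)
    (ι : N → M) (p : N) (v : TangentSpace I (ι p)) : ℝ :=
  InnerProductGeometry.angle (J (ι p) v)
    ((imageTangentSpace I' I ι p).starProjection (J (ι p) v))

/-- The submanifold `ι : N → M` is slant: the Wirtinger angle is the same for all nonzero tangent
vectors at all points. -/
def IsSlantSubmanifold (J : ∀ x : M, TangentSpace I x →L[ℝ] TangentSpace I x)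
    (ι : N → M) : Prop :=
  ∃ θ : ℝ, ∀ p : N, ∀ v ∈ imageTangentSpace I' I ι p, v ≠ 0 → wirtingerAngle I' I J ι p v = θ

/-- A slant submanifold is proper if it is neither holomorphic nor totally real. -/
def IsProperSlantSubmanifold (J : ∀ x : M, TangentSpace I x →L[ℝ] TangentSpace I x)
    (ι : N → M) : Prop :=
  IsSlantSubmanifold I' I J ι ∧ ¬ IsHolomorphicSubmanifold I' I J ι ∧
    ¬ IsTotallyRealSubmanifold I' I J ι

variable [RiemannianBundle (fun p : N ↦ TangentSpace I' p)]

/-- `ι` is a smooth map with `g (dι v, dι w) = g (v, w)`. As metrics are positive definite, such a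
map is an immersion. -/
structure IsIsometricImmersion (ι : N → M) : Prop where
  contMDiff : ContMDiff I' I ∞ ι
  inner_mfderiv : ∀ (p : N) (v w : TangentSpace I' p),
    inner ℝ (mfderiv I' I ι p v) (mfderiv I' I ι p w) = inner ℝ v w

end Submanifold

section WarpedProduct

variable {E₁ : Type*} [NormedAddCommGroup E₁] [NormedSpace ℝ E₁]
  {H₁ : Type*} [TopologicalSpace H₁] (I₁ : ModelWithCorners ℝ E₁ H₁)
  {N₁ : Type*} [TopologicalSpace N₁] [ChartedSpace H₁ N₁]
  [RiemannianBundle (fun p : N₁ ↦ TangentSpace I₁ p)]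
  {E₂ : Type*} [NormedAddCommGroup E₂] [NormedSpace ℝ E₂]
  {H₂ : Type*} [TopologicalSpace H₂] (I₂ : ModelWithCorners ℝ E₂ H₂)
  {N₂ : Type*} [TopologicalSpace N₂] [ChartedSpace H₂ N₂]
  [RiemannianBundle (fun (p : N₁ × N₂) ↦ TangentSpace (I₁.prod I₂) p)]

/-- The Riemannian metric `g` carried by `N₁ × N₂` is the warped product metric
`π* g₁ + (f ∘ π)² ρ* g₂` of `N₁ ×_f N₂`, where `g₁`, `g₂` are the metrics carried by `N₁`, `N₂`, and
the warping function `f` is positive and smooth on `N₁`. -/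
structure IsWarpedProduct [RiemannianBundle (fun q : N₂ ↦ TangentSpace I₂ q)] (f : N₁ → ℝ) :
    Prop where
  contMDiff : ContMDiff I₁ 𝓘(ℝ, ℝ) ∞ f
  pos : ∀ p, 0 < f p
  inner_eq : ∀ (x : N₁ × N₂) (v w : TangentSpace (I₁.prod I₂) x),
    inner ℝ v w =
      inner ℝ (mfderiv (I₁.prod I₂) I₁ Prod.fst x v) (mfderiv (I₁.prod I₂) I₁ Prod.fst x w) +
      f x.1 ^ 2 *
        inner ℝ (mfderiv (I₁.prod I₂) I₂ Prod.snd x v) (mfderiv (I₁.prod I₂) I₂ Prod.snd x w)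

/-- The Riemannian metric `g` carried by `N₁ × N₂` is the Riemannian product metric
`π* g₁ + ρ* h`, where `g₁` is the metric carried by `N₁` and `h` is a Riemannian metric on `N₂`. -/
def IsRiemannianProduct [IsManifold I₂ 1 N₂]
    (h : ContMDiffRiemannianMetric I₂ ∞ E₂ (fun q : N₂ ↦ TangentSpace I₂ q)) : Prop :=
  ∀ (x : N₁ × N₂) (v w : TangentSpace (I₁.prod I₂) x),
    inner ℝ v w =
      inner ℝ (mfderiv (I₁.prod I₂) I₁ Prod.fst x v) (mfderiv (I₁.prod I₂) I₁ Prod.fst x w) +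
      h.inner x.2
        (mfderiv (I₁.prod I₂) I₂ Prod.snd x v) (mfderiv (I₁.prod I₂) I₂ Prod.snd x w)

end WarpedProduct

end NearlyKaehler

end

noncomputable section

namespace NearlyKaehler

open Filter Topology FiberBundle

section Coordinates

variable {V : Type*} [NormedAddCommGroup V] [NormedSpace ℝ V]
  {E : Type*} [NormedAddCommGroup E] [NormedSpace ℝ E]
  {u : V → E} {v₀ : V} {G : E → E →L[ℝ] E →L[ℝ] ℝ} {K : E → E →L[ℝ] E}

set_option synthInstance.maxHeartbeats 200000 in
/-- The covariant derivative, in coordinates, of fields along `u` is compatible with the metric. -/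
lemma hasFDerivAt_metric_along {Γ : E → E → E}
    (hu : DifferentiableAt ℝ u v₀) (hG : DifferentiableAt ℝ G (u v₀))
    (hmetric : ∀ v a b, fderiv ℝ G (u v₀) v a b = G (u v₀) (Γ v a) b + G (u v₀) a (Γ v b))
    {A B : V → E} (hA : DifferentiableAt ℝ A v₀) (hB : DifferentiableAt ℝ B v₀) :
    ∃ D : V →L[ℝ] ℝ, HasFDerivAt (fun v ↦ G (u v) (A v) (B v)) D v₀ ∧ ∀ w, D w =
      G (u v₀) (fderiv ℝ A v₀ w + Γ (fderiv ℝ u v₀ w) (A v₀)) (B v₀) +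
      G (u v₀) (A v₀) (fderiv ℝ B v₀ w + Γ (fderiv ℝ u v₀ w) (B v₀)) := by
  have hGu : HasFDerivAt (fun v ↦ G (u v)) ((fderiv ℝ G (u v₀)).comp (fderiv ℝ u v₀)) v₀ :=
    HasFDerivAt.comp (g := G) v₀ hG.hasFDerivAt hu.hasFDerivAt
  have h := (hGu.clm_apply hA.hasFDerivAt).clm_apply hB.hasFDerivAt
  refine ⟨_, h, fun w ↦ ?_⟩
  simp [hmetric]
  ring

set_option synthInstance.maxHeartbeats 200000 in
/-- If, in coordinates, `u` parametrizes a submanifold of a nearly Kaehler manifold whose `J`-invariant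
directions `e`, `e' = J e` are orthogonal to the direction `ζ`, then the logarithmic derivative `c` of
the metric in the direction `ζ` on the vectors `e`, `e'` vanishes. -/
lemma warping_mul_metric_eq_zero {Γ : E →ₗ[ℝ] E →ₗ[ℝ] E} {e e' ζ : V} {c : ℝ}
    (hu : ContDiffAt ℝ 2 u v₀) (hG : DifferentiableAt ℝ G (u v₀))
    (hK : DifferentiableAt ℝ K (u v₀))
    (hΓ : ∀ a b, Γ a b = Γ b a)
    (hmetric : ∀ v a b, fderiv ℝ G (u v₀) v a b = G (u v₀) (Γ v a) b + G (u v₀) a (Γ v b))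
    (hnk : ∀ a, fderiv ℝ K (u v₀) a a + Γ a (K (u v₀) a) - K (u v₀) (Γ a a) = 0)
    (hsymm : ∀ a b, G (u v₀) a b = G (u v₀) b a)
    (hKK : ∀ᶠ x in 𝓝 (u v₀), ∀ a, K x (K x a) = -a)
    (hGK : ∀ a b, G (u v₀) (K (u v₀) a) (K (u v₀) b) = G (u v₀) a b)
    (hee' : K (u v₀) (fderiv ℝ u v₀ e) = fderiv ℝ u v₀ e')
    (horth : ∀ w ∈ ({e, e'} : Set V), ∀ᶠ v in 𝓝 v₀,
      G (u v) (fderiv ℝ u v w) (fderiv ℝ u v ζ) = 0)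
    (hKorth : ∀ w ∈ ({e, e'} : Set V), ∀ᶠ v in 𝓝 v₀,
      G (u v) (K (u v) (fderiv ℝ u v w)) (fderiv ℝ u v ζ) = 0)
    (hwarp : ∀ w ∈ ({e, e'} : Set V),
      HasDerivAt (fun s : ℝ ↦ G (u (v₀ + s • ζ)) (fderiv ℝ u (v₀ + s • ζ) w)
        (fderiv ℝ u (v₀ + s • ζ) w))
        (2 * c * G (u v₀) (fderiv ℝ u v₀ w) (fderiv ℝ u v₀ w)) 0) :
    c * G (u v₀) (fderiv ℝ u v₀ e) (fderiv ℝ u v₀ e) = 0 := by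
  have hu1 : DifferentiableAt ℝ u v₀ := hu.differentiableAt (by norm_num)
  have hdu : DifferentiableAt ℝ (fderiv ℝ u) v₀ :=
    (hu.fderiv_right (m := 1) (by norm_num)).differentiableAt (by norm_num)
  have hS : ∀ a b, fderiv ℝ (fderiv ℝ u) v₀ a b = fderiv ℝ (fderiv ℝ u) v₀ b a :=
    fun a b ↦ (hu.isSymmSndFDerivAt (by simp)).eq a b
  set x := u v₀ with hx
  set H : V → V → E := fun w w' ↦
    fderiv ℝ (fderiv ℝ u) v₀ w w' + Γ (fderiv ℝ u v₀ w) (fderiv ℝ u v₀ w') with hH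
  have hHs : ∀ w w', H w w' = H w' w := fun w w' ↦ by simp only [hH]; rw [hS, hΓ]
  have hdw : ∀ w, DifferentiableAt ℝ (fun v ↦ fderiv ℝ u v w) v₀ := fun w ↦
    hdu.clm_apply (differentiableAt_const w)
  have hdw' : ∀ w w', fderiv ℝ (fun v ↦ fderiv ℝ u v w) v₀ w' =
      fderiv ℝ (fderiv ℝ u) v₀ w' w := fun w w' ↦ by
    have := hdu.hasFDerivAt.clm_apply (hasFDerivAt_const w v₀)
    rw [this.fderiv]; simp
  have hKu : DifferentiableAt ℝ (fun v ↦ K (u v)) v₀ := hK.comp v₀ hu1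
  have hdK : ∀ w, DifferentiableAt ℝ (fun v ↦ K (u v) (fderiv ℝ u v w)) v₀ := fun w ↦
    hKu.clm_apply (hdw w)
  set T : E → E → E := fun a b ↦ fderiv ℝ K x a b + Γ a (K x b) - K x (Γ a b) with hT
  have hTanti : ∀ a b, T a b = - T b a := fun a b ↦ by
    have h1 := hnk (a + b)
    have h2 := hnk a
    have h3 := hnk b
    simp only [map_add, LinearMap.add_apply, add_apply] at h1
    simp only [hT]
    linear_combination (norm := module) h1 - h2 - h3
  have hTK : ∀ a b, T a (K x b) = - K x (T a b) := fun a b ↦ by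
    have h1 : HasFDerivAt (fun y ↦ K y (K y b)) _ x :=
      hK.hasFDerivAt.clm_apply (hK.hasFDerivAt.clm_apply (hasFDerivAt_const b x))
    have h2 : HasFDerivAt (fun y ↦ K y (K y b)) (0 : E →L[ℝ] E) x :=
      (hasFDerivAt_const (-b) x).congr_of_eventuallyEq (hKK.mono fun y hy ↦ hy b)
    have h3 := congr($(h1.unique h2) a)
    have h4 := hKK.self_of_nhds
    simp at h3
    simp only [hT, map_add, map_sub, h4, map_neg]
    rw [← sub_eq_zero, ← h3]
    abel
  have hdK' : ∀ w w', fderiv ℝ (fun v ↦ K (u v) (fderiv ℝ u v w)) v₀ w' +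
      Γ (fderiv ℝ u v₀ w') (K x (fderiv ℝ u v₀ w)) =
      T (fderiv ℝ u v₀ w') (fderiv ℝ u v₀ w) + K x (H w' w) := fun w w' ↦ by
    have := (hK.hasFDerivAt.comp v₀ hu1.hasFDerivAt).clm_apply (hdw w).hasFDerivAt
    have h2 : fderiv ℝ (fun v ↦ K (u v) (fderiv ℝ u v w)) v₀ = _ := this.fderiv
    rw [h2]
    simp [hT, hH, hdw', ← hx]
    abel
  have hzero : ∀ {A B : V → E}, DifferentiableAt ℝ A v₀ → DifferentiableAt ℝ B v₀ →
      (∀ᶠ v in 𝓝 v₀, G (u v) (A v) (B v) = 0) → ∀ w,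
      G x (fderiv ℝ A v₀ w + Γ (fderiv ℝ u v₀ w) (A v₀)) (B v₀) +
      G x (A v₀) (fderiv ℝ B v₀ w + Γ (fderiv ℝ u v₀ w) (B v₀)) = 0 := by
    intro A B hA hB h0 w
    obtain ⟨D, hD, hDw⟩ := hasFDerivAt_metric_along (Γ := fun a b ↦ Γ a b) hu1 hG hmetric hA hB
    rw [← hDw, hD.unique ((hasFDerivAt_const (0 : ℝ) v₀).congr_of_eventuallyEq h0)]
    simp
  have hw2 : ∀ w ∈ ({e, e'} : Set V),
      G x (fderiv ℝ u v₀ w) (H w ζ) = c * G x (fderiv ℝ u v₀ w) (fderiv ℝ u v₀ w) := by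
    intro w hw
    obtain ⟨D, hD, hDw⟩ := hasFDerivAt_metric_along (Γ := fun a b ↦ Γ a b) hu1 hG hmetric
      (hdw w) (hdw w)
    have hline : HasDerivAt (fun s : ℝ ↦ v₀ + s • ζ) ζ 0 := by
      simpa using ((hasDerivAt_id (0 : ℝ)).smul_const ζ).const_add v₀
    have hD0 : HasFDerivAt (fun v ↦ G (u v) (fderiv ℝ u v w) (fderiv ℝ u v w)) D
      (v₀ + (0 : ℝ) • ζ) := by simpa using hD
    have h0 : HasDerivAt (fun s : ℝ ↦ G (u (v₀ + s • ζ)) (fderiv ℝ u (v₀ + s • ζ) w)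
        (fderiv ℝ u (v₀ + s • ζ) w)) (D ζ) 0 := by
      exact HasFDerivAt.comp_hasDerivAt
        (l := fun v ↦ G (u v) (fderiv ℝ u v w) (fderiv ℝ u v w)) (0 : ℝ) hD0 hline
    have h1 := h0.unique (hwarp w hw)
    rw [hDw, hdw', hsymm (fderiv ℝ (fderiv ℝ u) v₀ ζ w + _)] at h1
    rw [hHs]
    simp only [hH]
    linarith
  have h1 := hzero (hdw e) (hdw ζ) (horth e (by simp)) e
  have h3 := hzero (hdK e) (hdw ζ) (hKorth e (by simp)) e'
  have h4 := hzero (hdK e') (hdw ζ) (hKorth e' (by simp)) e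
  simp only [hdw', hdK', ← hx] at h1 h3 h4
  change G x (H e e) _ + G x _ (H e ζ) = 0 at h1
  change _ + G x _ (H e' ζ) = 0 at h3
  change _ + G x _ (H e ζ) = 0 at h4
  have hTaa : T (fderiv ℝ u v₀ e) (fderiv ℝ u v₀ e) = 0 := hnk _
  have hTab : T (fderiv ℝ u v₀ e) (fderiv ℝ u v₀ e') = 0 := by
    rw [← hee', hTK, hTaa]; simp
  have hKe' : K x (fderiv ℝ u v₀ e') = - fderiv ℝ u v₀ e := by
    rw [← hee', hKK.self_of_nhds]
  rw [hTanti, hTab, hee', hw2 e' (by simp), ← hee', hGK, hHs e' e] at h3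
  rw [hTab, hKe', map_neg, neg_apply, hw2 e (by simp)] at h4
  simp only [neg_zero, zero_add] at h3 h4
  linarith

end Coordinates

section TangentCoordinates

variable {E : Type*} [NormedAddCommGroup E] [NormedSpace ℝ E]
  {M : Type*} [TopologicalSpace M] [ChartedSpace E M]

/-- The derivative at `x` of a vector-valued function is its derivative in the chart at `x`. -/
lemma mvfderiv_eq_fderiv_extChartAt {F : Type*} [NormedAddCommGroup F] [NormedSpace ℝ F]
    {h : M → F} {x : M} (hh : MDifferentiableAt 𝓘(ℝ, E) 𝓘(ℝ, F) h x) (v : E) :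
    mvfderiv 𝓘(ℝ, E) h x v =
      fderiv ℝ (h ∘ (extChartAt 𝓘(ℝ, E) x).symm) (extChartAt 𝓘(ℝ, E) x x) v := by
  simp [mvfderiv, mfderiv, hh, writtenInExtChartAt, Function.comp_def]
  rfl

lemma mvfderiv_congr {F : Type*} [NormedAddCommGroup F] [NormedSpace ℝ F]
    {h h' : M → F} {x : M} (hh : h =ᶠ[𝓝 x] h') (v : E) :
    mvfderiv 𝓘(ℝ, E) h x v = mvfderiv 𝓘(ℝ, E) h' x v := by
  have := hh.mfderiv_eq (I := 𝓘(ℝ, E)) (I' := 𝓘(ℝ, F))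
  simp only [mvfderiv]
  exact congr($this v)

variable [IsManifold 𝓘(ℝ, E) ∞ M]

/-- The coordinates of the tangent vector `v` at `z` in the chart at `x`. -/
def tangentCoord (x : M) (z : M) (v : TangentSpace 𝓘(ℝ, E) z) : E :=
  (trivializationAt E (TangentSpace 𝓘(ℝ, E)) x).continuousLinearMapAt ℝ z v

/-- The vector field near `x` with constant coordinates `a` in the chart at `x`. -/
def constantField (x : M) (a : E) (z : M) : TangentSpace 𝓘(ℝ, E) z :=
  (trivializationAt E (TangentSpace 𝓘(ℝ, E)) x).symmL ℝ z a

lemma tangentCoord_self (x : M) (v : TangentSpace 𝓘(ℝ, E) x) : tangentCoord x x v = v := by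
  rw [tangentCoord, TangentBundle.continuousLinearMapAt_trivializationAt (by simp),
    mfderiv_extChartAt_self]
  rfl

lemma tangentCoord_eq_mfderiv {x z : M} (hz : z ∈ (chartAt E x).source)
    (v : TangentSpace 𝓘(ℝ, E) z) :
    tangentCoord x z v = mfderiv 𝓘(ℝ, E) 𝓘(ℝ, E) (extChartAt 𝓘(ℝ, E) x) z v := by
  rw [tangentCoord, TangentBundle.continuousLinearMapAt_trivializationAt hz]
  rfl

lemma constantField_tangentCoord {x z : M} (hz : z ∈ (chartAt E x).source)
    (v : TangentSpace 𝓘(ℝ, E) z) : constantField x (tangentCoord x z v) z = v :=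
  (trivializationAt E (TangentSpace 𝓘(ℝ, E)) x).symmL_continuousLinearMapAt hz v

lemma tangentCoord_constantField {x z : M} (hz : z ∈ (chartAt E x).source) (a : E) :
    tangentCoord x z (constantField x a z) = a :=
  (trivializationAt E (TangentSpace 𝓘(ℝ, E)) x).continuousLinearMapAt_symmL hz a

lemma constantField_self (x : M) (a : E) : constantField x a x = a := by
  rw [← tangentCoord_self x (constantField x a x)]
  exact tangentCoord_constantField (mem_chart_source E x) a

lemma extend_eq_constantField {x z : M} (hz : z ∈ (chartAt E x).source) (a : E) :
    extend E (E := fun z : M ↦ TangentSpace 𝓘(ℝ, E) z) (x := x) a z = constantField x a z := by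
  have : (trivializationAt E (TangentSpace 𝓘(ℝ, E)) x ⟨x, a⟩).2 = a :=
    (congrFun (Trivialization.coe_linearMapAt_of_mem (R := ℝ) _
      (mem_baseSet_trivializationAt' x)) _).symm.trans (tangentCoord_self (E := E) x a)
  simp only [extend]
  rw [this]
  exact (Trivialization.symmL_apply (R := ℝ) _ hz _).symm

lemma isDifferentiableFieldAt_constantField [FiniteDimensional ℝ E] (x : M) (a : E) :
    IsDifferentiableFieldAt 𝓘(ℝ, E) (constantField x a) x := by
  have h := mdifferentiableAt_extend 𝓘(ℝ, E) E
    (V := fun z : M ↦ TangentSpace 𝓘(ℝ, E) z) (x := x) a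
  refine h.congr_of_eventuallyEq ?_
  filter_upwards [(chartAt E x).open_source.mem_nhds (mem_chart_source E x)] with z hz
  rw [extend_eq_constantField hz]

lemma mdifferentiableAt_tangentCoord [FiniteDimensional ℝ E] {x : M}
    {σ : ∀ z : M, TangentSpace 𝓘(ℝ, E) z}
    (hσ : IsDifferentiableFieldAt 𝓘(ℝ, E) σ x) :
    MDifferentiableAt 𝓘(ℝ, E) 𝓘(ℝ, E) (fun z ↦ tangentCoord x z (σ z)) x := by
  have h := (mdifferentiableAt_totalSpace 𝓘(ℝ, E) _).1 hσ
  refine h.2.congr_of_eventuallyEq ?_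
  filter_upwards [(chartAt E x).open_source.mem_nhds (mem_chart_source E x)] with z hz
  rw [tangentCoord, Trivialization.continuousLinearMapAt_apply,
    Trivialization.coe_linearMapAt_of_mem _ hz]

lemma mlieBracket_constantField (x : M) (a b : E) :
    VectorField.mlieBracket 𝓘(ℝ, E) (constantField x a) (constantField x b) x = 0 := by
  have key : ∀ a : E, VectorField.mpullbackWithin 𝓘(ℝ, E) 𝓘(ℝ, E) (extChartAt 𝓘(ℝ, E) x).symm
      (constantField x a) (Set.range 𝓘(ℝ, E)) =ᶠ[𝓝 (extChartAt 𝓘(ℝ, E) x x)] fun _ ↦ a := by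
    intro a
    filter_upwards [extChartAt_target_mem_nhds (I := 𝓘(ℝ, E)) x] with y hy
    have hz : (extChartAt 𝓘(ℝ, E) x).symm y ∈ (chartAt E x).source := by
      simpa using (extChartAt 𝓘(ℝ, E) x).map_target hy
    rw [VectorField.mpullbackWithin_apply, constantField,
      TangentBundle.symmL_trivializationAt hz, PartialEquiv.right_inv _ hy]
    exact (isInvertible_mfderivWithin_extChartAt_symm hy).inverse_apply_self a
  rw [← VectorField.mlieBracketWithin_univ, VectorField.mlieBracketWithin_apply]
  have h0 : ∀ (X Y : E → E) (p : E), X =ᶠ[𝓝 p] (fun _ ↦ a) → Y =ᶠ[𝓝 p] (fun _ ↦ b) →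
      VectorField.lieBracketWithin ℝ X Y Set.univ p = 0 := by
    intro X Y p hX hY
    rw [VectorField.lieBracketWithin_univ, hX.lieBracket_vectorField_eq hY]
    simp [VectorField.lieBracket]
  have hU : (extChartAt 𝓘(ℝ, E) x).symm ⁻¹' Set.univ ∩ Set.range 𝓘(ℝ, E) = Set.univ := by simp
  rw [hU]
  exact (congrArg _ (h0 _ _ _ (key a) (key b))).trans (map_zero _)

variable [FiniteDimensional ℝ E]

/-- The coordinates of the covariant derivative at `x` of the field `σ` in the direction `v`. -/
def covDerivCoord (nabla : CovariantDerivative 𝓘(ℝ, E) E (fun x : M ↦ TangentSpace 𝓘(ℝ, E) x))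
    (x : M) (σ : ∀ z : M, TangentSpace 𝓘(ℝ, E) z) (v : E) : E :=
  nabla σ x v

/-- The Christoffel symbols at `x` of a covariant derivative, in the chart at `x`. -/
def christoffel (nabla : CovariantDerivative 𝓘(ℝ, E) E (fun x : M ↦ TangentSpace 𝓘(ℝ, E) x))
    (x : M) (v a : E) : E :=
  covDerivCoord nabla x (constantField x a) v

/-- In a chart a covariant derivative is the sum of the derivative of the coordinates and of a
Christoffel term. -/
lemma covDerivCoord_eq_mvfderiv_add
    (nabla : CovariantDerivative 𝓘(ℝ, E) E (fun x : M ↦ TangentSpace 𝓘(ℝ, E) x)) {x : M}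
    {σ : ∀ z : M, TangentSpace 𝓘(ℝ, E) z} (hσ : IsDifferentiableFieldAt 𝓘(ℝ, E) σ x) (v : E) :
    covDerivCoord nabla x σ v = mvfderiv 𝓘(ℝ, E) (fun z ↦ tangentCoord x z (σ z)) x v +
      christoffel nabla x v (tangentCoord x x (σ x)) := by
  set Φ : (∀ z : M, TangentSpace 𝓘(ℝ, E) z) → E := fun σ ↦ covDerivCoord nabla x σ v with hΦ
  set Ψ : (∀ z : M, TangentSpace 𝓘(ℝ, E) z) → E := fun σ ↦
      mvfderiv 𝓘(ℝ, E) (fun z ↦ tangentCoord x z (σ z)) x v with hΨ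
  have hT : TensorialAt 𝓘(ℝ, E) E (fun σ : ∀ z : M, TangentSpace 𝓘(ℝ, E) z ↦ Φ σ - Ψ σ) x := by
    constructor
    · intro f σ hf hσ
      have h1 : Φ (f • σ) = f x • Φ σ + mvfderiv 𝓘(ℝ, E) f x v • tangentCoord x x (σ x) := by
        rw [tangentCoord_self]
        exact congr($(nabla.isCovariantDerivativeOnUniv.leibniz hσ hf) v)
      have h2 : mvfderiv 𝓘(ℝ, E) (fun z ↦ f z • tangentCoord x z (σ z)) x v =
          f x • Ψ σ + mvfderiv 𝓘(ℝ, E) f x v • tangentCoord x x (σ x) :=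
        congr($(mvfderiv_smul hf (mdifferentiableAt_tangentCoord hσ)) v)
      have h3 : Ψ (f • σ) = mvfderiv 𝓘(ℝ, E) (fun z ↦ f z • tangentCoord x z (σ z)) x v := by
        simp [hΨ, tangentCoord]
      rw [h1, h3, h2]
      module
    · intro σ σ' hσ hσ'
      have h1 : Φ (σ + σ') = Φ σ + Φ σ' :=
        congr($(nabla.isCovariantDerivativeOnUniv.add hσ hσ') v)
      have h2 : mvfderiv 𝓘(ℝ, E) (fun z ↦ tangentCoord x z (σ z) + tangentCoord x z (σ' z)) x v =
          Ψ σ + Ψ σ' :=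
        congr($(mvfderiv_add (mdifferentiableAt_tangentCoord hσ)
          (mdifferentiableAt_tangentCoord hσ')) v)
      have h3 : Ψ (σ + σ') =
          mvfderiv 𝓘(ℝ, E) (fun z ↦ tangentCoord x z (σ z) + tangentCoord x z (σ' z)) x v := by
        simp [hΨ, tangentCoord]
      rw [h1, h3, h2]
      module
  have h := hT.pointwise hσ
    (isDifferentiableFieldAt_constantField x (tangentCoord x x (σ x)))
    (constantField_tangentCoord (mem_chart_source E x) _).symm
  have h0 : Ψ (constantField x (tangentCoord x x (σ x))) = 0 := by
    have : (fun z ↦ tangentCoord x z (constantField x (tangentCoord x x (σ x)) z))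
        =ᶠ[𝓝 x] fun _ ↦ tangentCoord x x (σ x) := by
      filter_upwards [(chartAt E x).open_source.mem_nhds (mem_chart_source E x)] with z hz
      exact tangentCoord_constantField hz _
    have h' := mvfderiv_congr this v
    rw [mvfderiv_const] at h'
    exact h'
  simp only [h0, sub_zero] at h
  change Φ σ = Ψ σ + Φ (constantField x (tangentCoord x x (σ x)))
  rw [← h]
  abel

lemma christoffel_symm
    {nabla : CovariantDerivative 𝓘(ℝ, E) E (fun x : M ↦ TangentSpace 𝓘(ℝ, E) x)}
    (h : nabla.torsion = 0) (x : M) (a b : E) :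
    christoffel nabla x a b = christoffel nabla x b a := by
  have := (CovariantDerivative.torsion_eq_zero_iff nabla).1 h
    (isDifferentiableFieldAt_constantField x a) (isDifferentiableFieldAt_constantField x b)
  rw [mlieBracket_constantField, constantField_self, constantField_self, sub_eq_zero] at this
  exact this

end TangentCoordinates

section ChartExpressions

variable {E : Type*} [NormedAddCommGroup E] [NormedSpace ℝ E]
  {M : Type*} [TopologicalSpace M] [ChartedSpace E M]

lemma differentiableAt_comp_extChartAt_symm {F : Type*} [NormedAddCommGroup F] [NormedSpace ℝ F]
    {h : M → F} {x : M} (hh : MDifferentiableAt 𝓘(ℝ, E) 𝓘(ℝ, F) h x) :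
    DifferentiableAt ℝ (h ∘ (extChartAt 𝓘(ℝ, E) x).symm) (extChartAt 𝓘(ℝ, E) x x) := by
  have := hh.differentiableWithinAt_writtenInExtChartAt
  simpa [writtenInExtChartAt, differentiableWithinAt_univ, chartAt_self_eq] using this

variable [IsManifold 𝓘(ℝ, E) ∞ M]

/-- The expression in the chart at `x` of a field of endomorphisms of the tangent spaces. -/
lemma exists_endomorphism_coord {J : ∀ x : M, TangentSpace 𝓘(ℝ, E) x →L[ℝ] TangentSpace 𝓘(ℝ, E) x}
    (hJ : ContMDiff 𝓘(ℝ, E) (𝓘(ℝ, E).prod 𝓘(ℝ, E →L[ℝ] E)) ∞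
      (fun x : M ↦ (TotalSpace.mk' (E →L[ℝ] E) x (J x) :
        TotalSpace (E →L[ℝ] E)
          (fun x : M ↦ TangentSpace 𝓘(ℝ, E) x →L[ℝ] TangentSpace 𝓘(ℝ, E) x)))) (x : M) :
    ∃ K : M → E →L[ℝ] E, MDifferentiableAt 𝓘(ℝ, E) 𝓘(ℝ, E →L[ℝ] E) K x ∧
      ∀ z ∈ (chartAt E x).source, ∀ a : E, K z a = tangentCoord x z (J z (constantField x a z)) := by
  refine ⟨_, (((contMDiffAt_hom_bundle _).1 hJ.contMDiffAt).2).mdifferentiableAt (by simp), ?_⟩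
  intro z hz a
  rfl

variable [RiemannianBundle (fun x : M ↦ TangentSpace 𝓘(ℝ, E) x)]
  [IsContMDiffRiemannianBundle 𝓘(ℝ, E) ∞ E (fun x : M ↦ TangentSpace 𝓘(ℝ, E) x)]

/-- The expression of the metric in the chart at `x`. -/
lemma exists_metric_coord (x : M) :
    ∃ G : M → E →L[ℝ] E →L[ℝ] ℝ, MDifferentiableAt 𝓘(ℝ, E) 𝓘(ℝ, E →L[ℝ] E →L[ℝ] ℝ) G x ∧
      ∀ z ∈ (chartAt E x).source, ∀ a b : E,
        G z a b = inner ℝ (constantField x a z) (constantField x b z) := by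
  obtain ⟨g, hg, hgi⟩ := IsContMDiffRiemannianBundle.exists_contMDiff (IB := 𝓘(ℝ, E)) (n := ∞)
    (F := E) (E := fun x : M ↦ TangentSpace 𝓘(ℝ, E) x)
  refine ⟨_, (((contMDiffAt_hom_bundle _).1 hg.contMDiffAt).2).mdifferentiableAt (by simp), ?_⟩
  intro z hz a b
  have := inCoordinates_apply_eq₂ (𝕜 := ℝ) (x₀ := x) (x := z) (ϕ := g z) (v := a) (w := b)
    (E₃ := fun _ : M ↦ ℝ) (F₃ := ℝ) hz hz (by simp)
  refine this.trans ?_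
  rw [hgi, constantField, constantField, Trivialization.symmL_apply _ hz, Trivialization.symmL_apply _ hz]
  simp

variable [FiniteDimensional ℝ E]

set_option synthInstance.maxHeartbeats 200000 in
/-- The data of a nearly Kaehler manifold, in the chart at `x`. -/
lemma IsNearlyKaehler.exists_coord
    {J : ∀ x : M, TangentSpace 𝓘(ℝ, E) x →L[ℝ] TangentSpace 𝓘(ℝ, E) x}
    (hJ : IsNearlyKaehler 𝓘(ℝ, E) J) (x : M) :
    ∃ (G : E → E →L[ℝ] E →L[ℝ] ℝ) (K : E → E →L[ℝ] E) (Γ : E →ₗ[ℝ] E →ₗ[ℝ] E),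
      (∀ z ∈ (chartAt E x).source, ∀ v w : TangentSpace 𝓘(ℝ, E) z,
        G (extChartAt 𝓘(ℝ, E) x z) (tangentCoord x z v) (tangentCoord x z w) = inner ℝ v w) ∧
      (∀ z ∈ (chartAt E x).source, ∀ v : TangentSpace 𝓘(ℝ, E) z,
        K (extChartAt 𝓘(ℝ, E) x z) (tangentCoord x z v) = tangentCoord x z (J z v)) ∧
      DifferentiableAt ℝ G (extChartAt 𝓘(ℝ, E) x x) ∧
      DifferentiableAt ℝ K (extChartAt 𝓘(ℝ, E) x x) ∧
      (∀ a b, Γ a b = Γ b a) ∧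
      (∀ v a b, fderiv ℝ G (extChartAt 𝓘(ℝ, E) x x) v a b =
        G (extChartAt 𝓘(ℝ, E) x x) (Γ v a) b + G (extChartAt 𝓘(ℝ, E) x x) a (Γ v b)) ∧
      (∀ a, fderiv ℝ K (extChartAt 𝓘(ℝ, E) x x) a a + Γ a (K (extChartAt 𝓘(ℝ, E) x x) a) -
        K (extChartAt 𝓘(ℝ, E) x x) (Γ a a) = 0) := by
  obtain ⟨hH, nabla, hLC, hnk⟩ := hJ
  obtain ⟨G, hGd, hG⟩ := exists_metric_coord (E := E) x
  obtain ⟨K, hKd, hK⟩ := exists_endomorphism_coord hH.contMDiff x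
  have hx := mem_chart_source E x
  have hnhds : (chartAt E x).source ∈ 𝓝 x := (chartAt E x).open_source.mem_nhds hx
  have hsymm := christoffel_symm hLC.torsion_eq_zero x
  have hleft : ∀ z ∈ (chartAt E x).source,
      (extChartAt 𝓘(ℝ, E) x).symm (extChartAt 𝓘(ℝ, E) x z) = z := fun z hz ↦
    (extChartAt 𝓘(ℝ, E) x).left_inv (by simpa using hz)
  have hadd : ∀ v v' a, christoffel nabla x (v + v') a =
      christoffel nabla x v a + christoffel nabla x v' a := fun v v' a ↦
    map_add (nabla (constantField x a) x) _ _
  have hsmul : ∀ (c : ℝ) v a, christoffel nabla x (c • v) a = c • christoffel nabla x v a :=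
    fun c v a ↦ map_smul (nabla (constantField x a) x) _ _
  refine ⟨G ∘ (extChartAt 𝓘(ℝ, E) x).symm, K ∘ (extChartAt 𝓘(ℝ, E) x).symm,
    LinearMap.mk₂ ℝ (christoffel nabla x) hadd hsmul
      (fun v a b ↦ by rw [hsymm, hadd, hsymm a, hsymm b])
      (fun c v a ↦ by rw [hsymm, hsmul, hsymm a]), ?_, ?_,
    differentiableAt_comp_extChartAt_symm hGd, differentiableAt_comp_extChartAt_symm hKd,
    hsymm, ?_, ?_⟩
  · intro z hz v w
    rw [Function.comp_apply, hleft z hz, hG z hz, constantField_tangentCoord hz,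
      constantField_tangentCoord hz]
  · intro z hz v
    rw [Function.comp_apply, hleft z hz, hK z hz, constantField_tangentCoord hz]
  · intro v a b
    have h1 : mvfderiv 𝓘(ℝ, E) (fun z ↦ inner ℝ (constantField x a z) (constantField x b z)) x v =
        inner ℝ (nabla (constantField x a) x v) (constantField x b x) +
        inner ℝ (constantField x a x) (nabla (constantField x b) x v) :=
      hLC.metric _ _ x (isDifferentiableFieldAt_constantField x a)
        (isDifferentiableFieldAt_constantField x b) v
    have h2 : (fun z ↦ G z a b) =ᶠ[𝓝 x]
        fun z ↦ inner ℝ (constantField x a z) (constantField x b z) := by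
      filter_upwards [hnhds] with z hz using hG z hz a b
    have hGab : MDifferentiableAt 𝓘(ℝ, E) 𝓘(ℝ, ℝ) (fun z ↦ G z a b) x :=
      (hGd.clm_apply mdifferentiableAt_const).clm_apply mdifferentiableAt_const
    rw [← mvfderiv_congr h2, mvfderiv_eq_fderiv_extChartAt hGab] at h1
    have h3 := ((differentiableAt_comp_extChartAt_symm hGd).hasFDerivAt.clm_apply
      (hasFDerivAt_const a _)).clm_apply (hasFDerivAt_const b _)
    have h4 : fderiv ℝ ((fun z ↦ G z a b) ∘ (extChartAt 𝓘(ℝ, E) x).symm)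
      (extChartAt 𝓘(ℝ, E) x x) = _ := h3.fderiv
    rw [h4] at h1
    simp only [Function.comp_apply, hleft x hx, hG x hx]
    have h5 : ∀ c, constantField x (christoffel nabla x v c) x = nabla (constantField x c) x v :=
      fun c ↦ constantField_self x _
    rw [LinearMap.mk₂_apply, LinearMap.mk₂_apply, h5, h5, ← h1]
    simp
  · intro a
    have hd : IsDifferentiableFieldAt 𝓘(ℝ, E) (fun z ↦ J z (constantField x a z)) x :=
      MDifferentiableAt.clm_bundle_apply (hH.contMDiff.mdifferentiableAt (by simp))
        (isDifferentiableFieldAt_constantField x a)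
    have h1 := hnk (constantField x a) x (isDifferentiableFieldAt_constantField x a)
    rw [covDerivEndo, constantField_self, sub_eq_zero] at h1
    have h2 := covDerivCoord_eq_mvfderiv_add nabla hd a
    have h3 : (fun z ↦ K z a) =ᶠ[𝓝 x] fun z ↦ tangentCoord x z (J z (constantField x a z)) := by
      filter_upwards [hnhds] with z hz using hK z hz a
    have hKa : MDifferentiableAt 𝓘(ℝ, E) 𝓘(ℝ, E) (fun z ↦ K z a) x :=
      hKd.clm_apply mdifferentiableAt_const
    rw [← mvfderiv_congr h3, mvfderiv_eq_fderiv_extChartAt hKa, ← hK x hx] at h2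
    have h4 : fderiv ℝ ((fun z ↦ K z a) ∘ (extChartAt 𝓘(ℝ, E) x).symm)
      (extChartAt 𝓘(ℝ, E) x x) = _ :=
      ((differentiableAt_comp_extChartAt_symm hKd).hasFDerivAt.clm_apply
        (hasFDerivAt_const a _)).fderiv
    rw [h4] at h2
    have h5 : K x (christoffel nabla x a a) = covDerivCoord nabla x
        (fun z ↦ J z (constantField x a z)) a := by
      rw [hK x hx, tangentCoord_self]
      refine Eq.trans ?_ h1.symm
      exact congrArg (J x) (constantField_self x _)
    rw [LinearMap.mk₂_apply, LinearMap.mk₂_apply]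
    simp only [Function.comp_apply, hleft x hx]
    rw [h5, h2]
    simp

end ChartExpressions

section ChainRule

variable {E : Type*} [NormedAddCommGroup E] [NormedSpace ℝ E]
  {M : Type*} [TopologicalSpace M] [ChartedSpace E M] [IsManifold 𝓘(ℝ, E) ∞ M]
  {E' : Type*} [NormedAddCommGroup E'] [NormedSpace ℝ E']
  {N : Type*} [TopologicalSpace N] [ChartedSpace E' N] [IsManifold 𝓘(ℝ, E') ∞ N]

/-- The derivative of a map between manifolds, in charts. -/
lemma fderiv_extChartAt_comp {ι : N → M} (hι : ContMDiff 𝓘(ℝ, E') 𝓘(ℝ, E) ∞ ι) {x : M} {n : N}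
    {y : E'} (hy : y ∈ (extChartAt 𝓘(ℝ, E') n).target)
    (hx : ι ((extChartAt 𝓘(ℝ, E') n).symm y) ∈ (chartAt E x).source) (e : E') :
    fderiv ℝ (fun t ↦ extChartAt 𝓘(ℝ, E) x (ι ((extChartAt 𝓘(ℝ, E') n).symm t))) y e =
      tangentCoord x _ (mfderiv 𝓘(ℝ, E') 𝓘(ℝ, E) ι ((extChartAt 𝓘(ℝ, E') n).symm y)
        (constantField n e ((extChartAt 𝓘(ℝ, E') n).symm y))) := by
  have hn : (extChartAt 𝓘(ℝ, E') n).symm y ∈ (chartAt E' n).source := by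
    simpa using (extChartAt 𝓘(ℝ, E') n).map_target hy
  have h1 : HasMFDerivAt 𝓘(ℝ, E') 𝓘(ℝ, E') (extChartAt 𝓘(ℝ, E') n).symm y
      (mfderivWithin 𝓘(ℝ, E') 𝓘(ℝ, E') (extChartAt 𝓘(ℝ, E') n).symm
        (Set.range 𝓘(ℝ, E')) y) := by
    have := (mdifferentiableWithinAt_extChartAt_symm hy).hasMFDerivWithinAt
    exact this.hasMFDerivAt (by simp)
  have h2 := (hι.mdifferentiableAt (by simp)
    (x := (extChartAt 𝓘(ℝ, E') n).symm y)).hasMFDerivAt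
  have h3 := (mdifferentiableAt_extChartAt (I := 𝓘(ℝ, E)) hx).hasMFDerivAt
  have h4 := (h3.comp y (h2.comp y h1)).mfderiv
  rw [← mfderiv_eq_fderiv]
  refine congr($h4 e).trans ?_
  rw [ tangentCoord_eq_mfderiv hx, constantField, TangentBundle.symmL_trivializationAt hn,
    (extChartAt 𝓘(ℝ, E') n).right_inv hy]
  rfl

end ChainRule

section LocallyConstant

variable {E : Type*} [NormedAddCommGroup E] [NormedSpace ℝ E]
  {N : Type*} [TopologicalSpace N] [ChartedSpace E N] [IsManifold 𝓘(ℝ, E) ∞ N]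

lemma isLocallyConstant_of_mfderiv_eq_zero {f : N → ℝ} (hf : MDifferentiable 𝓘(ℝ, E) 𝓘(ℝ, ℝ) f)
    (h : ∀ p, mfderiv 𝓘(ℝ, E) 𝓘(ℝ, ℝ) f p = 0) : IsLocallyConstant f := by
  rw [IsLocallyConstant.iff_eventually_eq]
  intro p
  obtain ⟨r, hr, hball⟩ := Metric.mem_nhds_iff.1 (extChartAt_target_mem_nhds (I := 𝓘(ℝ, E)) p)
  have hd : ∀ y ∈ Metric.ball (extChartAt 𝓘(ℝ, E) p p) r,
      HasFDerivAt (f ∘ (extChartAt 𝓘(ℝ, E) p).symm) (0 : E →L[ℝ] ℝ) y := by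
    intro y hy
    have h1 := ((mdifferentiableWithinAt_extChartAt_symm (hball hy)).hasMFDerivWithinAt).hasMFDerivAt
      (by simp)
    have h2 := ((hf ((extChartAt 𝓘(ℝ, E) p).symm y)).hasMFDerivAt.comp y h1).hasFDerivAt
    rw [h, ContinuousLinearMap.zero_comp] at h2
    exact h2
  have hconst : ∀ y ∈ Metric.ball (extChartAt 𝓘(ℝ, E) p p) r,
      f ((extChartAt 𝓘(ℝ, E) p).symm y) = f p := by
    intro y hy
    have := Metric.isOpen_ball.is_const_of_fderiv_eq_zero (𝕜 := ℝ)
      (convex_ball _ r).isPreconnected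
      (fun z hz ↦ (hd z hz).differentiableAt.differentiableWithinAt)
      (fun z hz ↦ (hd z hz).fderiv) hy (Metric.mem_ball_self hr)
    simpa using this
  filter_upwards [(chartAt E p).open_source.mem_nhds (mem_chart_source E p),
    (continuousAt_extChartAt (I := 𝓘(ℝ, E)) p).preimage_mem_nhds (Metric.ball_mem_nhds _ hr)] with z hz hz'
  rw [← hconst _ hz', (extChartAt 𝓘(ℝ, E) p).left_inv (by simpa using hz)]

end LocallyConstant

section Leaves

variable {E : Type*} [NormedAddCommGroup E] [NormedSpace ℝ E]
  {M : Type*} [TopologicalSpace M] [ChartedSpace E M]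
  {E₁ : Type*} [NormedAddCommGroup E₁] [NormedSpace ℝ E₁]
  {N₁ : Type*} [TopologicalSpace N₁] [ChartedSpace E₁ N₁]
  {E₂ : Type*} [NormedAddCommGroup E₂] [NormedSpace ℝ E₂]
  {N₂ : Type*} [TopologicalSpace N₂] [ChartedSpace E₂ N₂]
  {f : N₁ → ℝ} {φ : N₁ × N₂ → M}

lemma mfderiv_comp_prodMk_right
    (hφ : ContMDiff (𝓘(ℝ, E₁).prod 𝓘(ℝ, E₂)) 𝓘(ℝ, E) ∞ φ) (p : N₁) (q : N₂)
    (v : TangentSpace 𝓘(ℝ, E₂) q) :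
    mfderiv 𝓘(ℝ, E₂) 𝓘(ℝ, E) (fun q ↦ φ (p, q)) q v =
      mfderiv (𝓘(ℝ, E₁).prod 𝓘(ℝ, E₂)) 𝓘(ℝ, E) φ (p, q)
        (ContinuousLinearMap.inr ℝ (TangentSpace 𝓘(ℝ, E₁) p) (TangentSpace 𝓘(ℝ, E₂) q) v) := by
  have h := mfderiv_comp (I := 𝓘(ℝ, E₂)) (I' := 𝓘(ℝ, E₁).prod 𝓘(ℝ, E₂)) (I'' := 𝓘(ℝ, E))
    (f := fun q : N₂ ↦ (p, q)) (g := φ) q (hφ.mdifferentiableAt (by simp))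
    (mdifferentiableAt_const.prodMk mdifferentiableAt_id)
  rw [mfderiv_prod_right] at h
  exact congr($h v)

lemma mfderiv_comp_prodMk_left
    (hφ : ContMDiff (𝓘(ℝ, E₁).prod 𝓘(ℝ, E₂)) 𝓘(ℝ, E) ∞ φ) (p : N₁) (q : N₂)
    (v : TangentSpace 𝓘(ℝ, E₁) p) :
    mfderiv 𝓘(ℝ, E₁) 𝓘(ℝ, E) (fun p ↦ φ (p, q)) p v =
      mfderiv (𝓘(ℝ, E₁).prod 𝓘(ℝ, E₂)) 𝓘(ℝ, E) φ (p, q)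
        (ContinuousLinearMap.inl ℝ (TangentSpace 𝓘(ℝ, E₁) p) (TangentSpace 𝓘(ℝ, E₂) q) v) := by
  have h := mfderiv_comp (I := 𝓘(ℝ, E₁)) (I' := 𝓘(ℝ, E₁).prod 𝓘(ℝ, E₂)) (I'' := 𝓘(ℝ, E))
    (f := fun p : N₁ ↦ (p, q)) (g := φ) p (hφ.mdifferentiableAt (by simp))
    (mdifferentiableAt_id.prodMk mdifferentiableAt_const)
  rw [mfderiv_prod_left] at h
  exact congr($h v)

variable
  [RiemannianBundle (fun x : M ↦ TangentSpace 𝓘(ℝ, E) x)]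
  [RiemannianBundle (fun p : N₁ ↦ TangentSpace 𝓘(ℝ, E₁) p)]
  [RiemannianBundle (fun q : N₂ ↦ TangentSpace 𝓘(ℝ, E₂) q)]
  [RiemannianBundle (fun x : N₁ × N₂ ↦ TangentSpace (𝓘(ℝ, E₁).prod 𝓘(ℝ, E₂)) x)]

lemma inner_mfderiv_right_right (hf : IsWarpedProduct 𝓘(ℝ, E₁) (N₁ := N₁) 𝓘(ℝ, E₂) (N₂ := N₂) f)
    (hφ : IsIsometricImmersion (𝓘(ℝ, E₁).prod 𝓘(ℝ, E₂)) 𝓘(ℝ, E) φ) (p : N₁) (q : N₂)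
    (v w : TangentSpace 𝓘(ℝ, E₂) q) :
    inner ℝ (mfderiv 𝓘(ℝ, E₂) 𝓘(ℝ, E) (fun q ↦ φ (p, q)) q v)
      (mfderiv 𝓘(ℝ, E₂) 𝓘(ℝ, E) (fun q ↦ φ (p, q)) q w) = f p ^ 2 * inner ℝ v w := by
  have h := (hφ.inner_mfderiv (p, q)
    (ContinuousLinearMap.inr ℝ (TangentSpace 𝓘(ℝ, E₁) p) (TangentSpace 𝓘(ℝ, E₂) q) v)
    (ContinuousLinearMap.inr ℝ (TangentSpace 𝓘(ℝ, E₁) p) (TangentSpace 𝓘(ℝ, E₂) q) w)).trans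
    (hf.inner_eq (p, q) _ _)
  rw [← mfderiv_comp_prodMk_right hφ.contMDiff, ← mfderiv_comp_prodMk_right hφ.contMDiff,
    mfderiv_fst, mfderiv_snd] at h
  have h' : _ = inner ℝ (0 : TangentSpace 𝓘(ℝ, E₁) p) 0 + f p ^ 2 * inner ℝ v w := h
  simpa using h'

lemma inner_mfderiv_right_left (hf : IsWarpedProduct 𝓘(ℝ, E₁) (N₁ := N₁) 𝓘(ℝ, E₂) (N₂ := N₂) f)
    (hφ : IsIsometricImmersion (𝓘(ℝ, E₁).prod 𝓘(ℝ, E₂)) 𝓘(ℝ, E) φ) (p : N₁) (q : N₂)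
    (v : TangentSpace 𝓘(ℝ, E₂) q) (w : TangentSpace 𝓘(ℝ, E₁) p) :
    inner ℝ (mfderiv 𝓘(ℝ, E₂) 𝓘(ℝ, E) (fun q ↦ φ (p, q)) q v)
      (mfderiv 𝓘(ℝ, E₁) 𝓘(ℝ, E) (fun p ↦ φ (p, q)) p w) = 0 := by
  have h := (hφ.inner_mfderiv (p, q)
    (ContinuousLinearMap.inr ℝ (TangentSpace 𝓘(ℝ, E₁) p) (TangentSpace 𝓘(ℝ, E₂) q) v)
    (ContinuousLinearMap.inl ℝ (TangentSpace 𝓘(ℝ, E₁) p) (TangentSpace 𝓘(ℝ, E₂) q) w)).trans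
    (hf.inner_eq (p, q) _ _)
  rw [← mfderiv_comp_prodMk_right hφ.contMDiff, ← mfderiv_comp_prodMk_left hφ.contMDiff,
    mfderiv_fst, mfderiv_snd] at h
  have h' : _ = inner ℝ (0 : TangentSpace 𝓘(ℝ, E₁) p) w +
    f p ^ 2 * inner ℝ v (0 : TangentSpace 𝓘(ℝ, E₂) q) := h
  simpa using h'

end Leaves

section PartialDerivatives

variable {E₁ E₂ F : Type*} [NormedAddCommGroup E₁] [NormedSpace ℝ E₁]
  [NormedAddCommGroup E₂] [NormedSpace ℝ E₂] [NormedAddCommGroup F] [NormedSpace ℝ F]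

lemma fderiv_apply_zero_right {u : E₁ × E₂ → F} {v : E₁ × E₂} (hu : DifferentiableAt ℝ u v) (e : E₂) :
    fderiv ℝ u v (0, e) = fderiv ℝ (fun t ↦ u (v.1, t)) v.2 e := by
  have h : HasFDerivAt (fun t ↦ u (v.1, t)) _ v.2 :=
    HasFDerivAt.comp (g := u) v.2 (by exact hu.hasFDerivAt) (hasFDerivAt_prodMk_right v.1 v.2)
  rw [h.fderiv]
  simp

lemma fderiv_apply_zero_left {u : E₁ × E₂ → F} {v : E₁ × E₂} (hu : DifferentiableAt ℝ u v) (e : E₁) :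
    fderiv ℝ u v (e, 0) = fderiv ℝ (fun t ↦ u (t, v.2)) v.1 e := by
  have h : HasFDerivAt (fun t ↦ u (t, v.2)) _ v.1 :=
    HasFDerivAt.comp (g := u) v.1 (by exact hu.hasFDerivAt) (hasFDerivAt_prodMk_left v.1 v.2)
  rw [h.fderiv]
  simp

end PartialDerivatives

variable {E : Type*} [NormedAddCommGroup E] [NormedSpace ℝ E] [FiniteDimensional ℝ E]
  {M : Type*} [TopologicalSpace M] [ChartedSpace E M] [IsManifold 𝓘(ℝ, E) ∞ M]
  [RiemannianBundle (fun x : M ↦ TangentSpace 𝓘(ℝ, E) x)]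
  [IsContMDiffRiemannianBundle 𝓘(ℝ, E) ∞ E (fun x : M ↦ TangentSpace 𝓘(ℝ, E) x)]
  {J : ∀ x : M, TangentSpace 𝓘(ℝ, E) x →L[ℝ] TangentSpace 𝓘(ℝ, E) x}
  {E₁ : Type*} [NormedAddCommGroup E₁] [NormedSpace ℝ E₁]
  {N₁ : Type*} [TopologicalSpace N₁] [ChartedSpace E₁ N₁] [IsManifold 𝓘(ℝ, E₁) ∞ N₁]
  [RiemannianBundle (fun p : N₁ ↦ TangentSpace 𝓘(ℝ, E₁) p)]
  {E₂ : Type*} [NormedAddCommGroup E₂] [NormedSpace ℝ E₂] [Nontrivial E₂]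
  {N₂ : Type*} [TopologicalSpace N₂] [ChartedSpace E₂ N₂] [IsManifold 𝓘(ℝ, E₂) ∞ N₂]
  [RiemannianBundle (fun q : N₂ ↦ TangentSpace 𝓘(ℝ, E₂) q)]
  [RiemannianBundle (fun x : N₁ × N₂ ↦ TangentSpace (𝓘(ℝ, E₁).prod 𝓘(ℝ, E₂)) x)]
  {f : N₁ → ℝ} {φ : N₁ × N₂ → M}

set_option synthInstance.maxHeartbeats 200000 in
/-- The warping function of a warped product immersed isometrically in a nearly Kaehler manifold
with holomorphic fibres is critical at every point: holomorphic submanifolds are minimal, while the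
fibres are totally umbilical with mean curvature `-grad (log f)`. -/
theorem mfderiv_warping_eq_zero (hJ : IsNearlyKaehler 𝓘(ℝ, E) J)
    (hf : IsWarpedProduct 𝓘(ℝ, E₁) (N₁ := N₁) 𝓘(ℝ, E₂) (N₂ := N₂) f)
    (hφ : IsIsometricImmersion (𝓘(ℝ, E₁).prod 𝓘(ℝ, E₂)) 𝓘(ℝ, E) φ)
    (hhol : ∀ p : N₁, IsHolomorphicSubmanifold 𝓘(ℝ, E₂) 𝓘(ℝ, E) J (fun q : N₂ ↦ φ (p, q)))
    (p₀ : N₁) (q₀ : N₂) :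
    mfderiv 𝓘(ℝ, E₁) 𝓘(ℝ, ℝ) f p₀ = 0 := by
  obtain ⟨G, K, Γ, hG, hK, hGd, hKd, hΓ, hmet, hnk⟩ := hJ.exists_coord (φ (p₀, q₀))
  set x₀ := φ (p₀, q₀) with hx₀
  set ξ := extChartAt 𝓘(ℝ, E) x₀ with hξ
  set η₁ := extChartAt 𝓘(ℝ, E₁) p₀ with hη₁
  set η₂ := extChartAt 𝓘(ℝ, E₂) q₀ with hη₂
  set u : E₁ × E₂ → E := fun v ↦ ξ (φ (η₁.symm v.1, η₂.symm v.2)) with hu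
  set v₀ : E₁ × E₂ := (η₁ p₀, η₂ q₀) with hv₀
  have hp₀ : η₁.symm (η₁ p₀) = p₀ := extChartAt_to_inv p₀
  have hq₀ : η₂.symm (η₂ q₀) = q₀ := extChartAt_to_inv q₀
  have huv₀ : u v₀ = ξ x₀ := by simp only [hu, hv₀, hp₀, hq₀, hx₀]
  have hx₀s : x₀ ∈ (chartAt E x₀).source := mem_chart_source E x₀
  -- the chart expression `u` of the immersion is smooth
  have hψ : ContMDiffAt 𝓘(ℝ, E₁ × E₂) 𝓘(ℝ, E) ∞
      (fun v : E₁ × E₂ ↦ φ (η₁.symm v.1, η₂.symm v.2)) v₀ := by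
    have h1 : ContMDiffAt 𝓘(ℝ, E₁ × E₂) 𝓘(ℝ, E₁) ∞ (fun v : E₁ × E₂ ↦ η₁.symm v.1) v₀ :=
      ((contMDiffOn_extChartAt_symm (I := 𝓘(ℝ, E₁)) (n := ∞) p₀).contMDiffAt
        (extChartAt_target_mem_nhds p₀)).comp v₀ contDiffAt_fst.contMDiffAt
    have h2 : ContMDiffAt 𝓘(ℝ, E₁ × E₂) 𝓘(ℝ, E₂) ∞ (fun v : E₁ × E₂ ↦ η₂.symm v.2) v₀ :=
      ((contMDiffOn_extChartAt_symm (I := 𝓘(ℝ, E₂)) (n := ∞) q₀).contMDiffAt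
        (extChartAt_target_mem_nhds q₀)).comp v₀ contDiffAt_snd.contMDiffAt
    exact hφ.contMDiff.contMDiffAt.comp v₀ (h1.prodMk h2)
  have hu2 : ContDiffAt ℝ 2 u v₀ := by
    have h1 : ContMDiffAt 𝓘(ℝ, E) 𝓘(ℝ, E) ∞ ξ (φ (η₁.symm v₀.1, η₂.symm v₀.2)) := by
      simp only [hv₀, hp₀, hq₀]
      exact contMDiffAt_extChartAt
    have h2 : ContMDiffAt 𝓘(ℝ, E₁ × E₂) 𝓘(ℝ, E) ∞ u v₀ := h1.comp v₀ hψ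
    exact h2.contDiffAt.of_le ENat.LEInfty.out
  have hgood : ∀ᶠ v in 𝓝 v₀, v.1 ∈ η₁.target ∧ v.2 ∈ η₂.target ∧
      φ (η₁.symm v.1, η₂.symm v.2) ∈ (chartAt E x₀).source ∧ DifferentiableAt ℝ u v := by
    refine (continuousAt_fst.eventually_mem (by exact extChartAt_target_mem_nhds (I := 𝓘(ℝ, E₁)) p₀)).and
      ((continuousAt_snd.eventually_mem (by exact extChartAt_target_mem_nhds (I := 𝓘(ℝ, E₂)) q₀)).and
      ((hψ.continuousAt.eventually_mem ?_).and ?_))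
    · simp only [hv₀, hp₀, hq₀]
      exact (chartAt E x₀).open_source.mem_nhds hx₀s
    · exact (hu2.eventually (by simp)).mono fun v hv ↦ hv.differentiableAt (by norm_num)
  have hright : ∀ v : E₁ × E₂, v.1 ∈ η₁.target ∧ v.2 ∈ η₂.target ∧
      φ (η₁.symm v.1, η₂.symm v.2) ∈ (chartAt E x₀).source ∧ DifferentiableAt ℝ u v →
      ∀ e : E₂, fderiv ℝ u v (0, e) = tangentCoord x₀ _ (mfderiv 𝓘(ℝ, E₂) 𝓘(ℝ, E)
        (fun q ↦ φ (η₁.symm v.1, q)) (η₂.symm v.2) (constantField q₀ e (η₂.symm v.2))) := by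
    rintro v ⟨-, h2, h3, h4⟩ e
    rw [fderiv_apply_zero_right h4]
    exact fderiv_extChartAt_comp (hφ.contMDiff.comp (contMDiff_const.prodMk contMDiff_id)) h2 h3 e
  have hleft : ∀ v : E₁ × E₂, v.1 ∈ η₁.target ∧ v.2 ∈ η₂.target ∧
      φ (η₁.symm v.1, η₂.symm v.2) ∈ (chartAt E x₀).source ∧ DifferentiableAt ℝ u v →
      ∀ e : E₁, fderiv ℝ u v (e, 0) = tangentCoord x₀ _ (mfderiv 𝓘(ℝ, E₁) 𝓘(ℝ, E)
        (fun p ↦ φ (p, η₂.symm v.2)) (η₁.symm v.1) (constantField p₀ e (η₁.symm v.1))) := by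
    rintro v ⟨h1, -, h3, h4⟩ e
    rw [fderiv_apply_zero_left h4]
    exact fderiv_extChartAt_comp (hφ.contMDiff.comp (contMDiff_id.prodMk contMDiff_const)) h1 h3 e
  have hJmem : ∀ p q (y : TangentSpace 𝓘(ℝ, E₂) q), ∃ y' : TangentSpace 𝓘(ℝ, E₂) q,
      mfderiv 𝓘(ℝ, E₂) 𝓘(ℝ, E) (fun q ↦ φ (p, q)) q y' =
        J _ (mfderiv 𝓘(ℝ, E₂) 𝓘(ℝ, E) (fun q ↦ φ (p, q)) q y) := by
    intro p q y
    have h := (hhol p q).le (Submodule.mem_map_of_mem (LinearMap.mem_range_self _ y))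
    exact h
  obtain ⟨e, he⟩ := exists_ne (0 : E₂)
  have hv₀good := hgood.self_of_nhds
  -- the direction `e'` with `J e = e'`
  obtain ⟨y', hy'⟩ := hJmem (η₁.symm v₀.1) (η₂.symm v₀.2) (constantField q₀ e (η₂.symm v₀.2))
  have hq₀s : η₂.symm v₀.2 ∈ (chartAt E₂ q₀).source := by
    simp only [hv₀, hq₀]; exact mem_chart_source E₂ q₀
  set e' : E₂ := tangentCoord q₀ _ y' with he'
  have hee' : K (u v₀) (fderiv ℝ u v₀ (0, e)) = fderiv ℝ u v₀ (0, e') := by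
    rw [hright v₀ hv₀good, hright v₀ hv₀good, he', constantField_tangentCoord hq₀s, hy']
    exact hK _ hv₀good.2.2.1 _
  set C : E₂ → E₂ → ℝ := fun e t ↦
    inner ℝ (constantField q₀ e (η₂.symm t)) (constantField q₀ e (η₂.symm t)) with hC
  have hnorm : ∀ v : E₁ × E₂, v.1 ∈ η₁.target ∧ v.2 ∈ η₂.target ∧
      φ (η₁.symm v.1, η₂.symm v.2) ∈ (chartAt E x₀).source ∧ DifferentiableAt ℝ u v →
      ∀ e : E₂, G (u v) (fderiv ℝ u v (0, e)) (fderiv ℝ u v (0, e)) =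
        f (η₁.symm v.1) ^ 2 * C e v.2 := by
    intro v hv e
    rw [hright v hv]
    exact (hG _ hv.2.2.1 _ _).trans (inner_mfderiv_right_right hf hφ _ _ _ _)
  have hfd : DifferentiableAt ℝ (f ∘ η₁.symm) (η₁ p₀) :=
    differentiableAt_comp_extChartAt_symm (hf.contMDiff.mdifferentiableAt (by simp))
  have hpos := hf.pos p₀
  have main : ∀ ζ : E₁, fderiv ℝ (f ∘ η₁.symm) (η₁ p₀) ζ = 0 := by
    intro ζ
    have key := warping_mul_metric_eq_zero (u := u) (v₀ := v₀) (G := G) (K := K) (Γ := Γ)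
      (e := (0, e)) (e' := (0, e')) (ζ := (ζ, 0))
      (c := fderiv ℝ (f ∘ η₁.symm) (η₁ p₀) ζ / f p₀) hu2 (huv₀ ▸ hGd) (huv₀ ▸ hKd) hΓ
      (huv₀ ▸ hmet) (huv₀ ▸ hnk) ?_ ?_ ?_ hee' ?_ ?_ ?_
    · rw [hnorm v₀ hv₀good] at key
      have h1 : 0 < C e v₀.2 := by
        refine real_inner_self_pos.2 fun h ↦ he ?_
        rw [← tangentCoord_constantField hq₀s e, h]
        exact map_zero _
      have h2 : f (η₁.symm v₀.1) = f p₀ := by simp only [hv₀, hp₀]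
      rw [h2] at key
      have h3 : f p₀ ^ 2 * C e v₀.2 ≠ 0 := by positivity
      have := (mul_eq_zero.1 key).resolve_right h3
      exact (div_eq_zero_iff.1 this).resolve_right hpos.ne'
    · intro a b
      rw [huv₀, ← tangentCoord_constantField hx₀s a, ← tangentCoord_constantField hx₀s b,
        hG _ hx₀s, hG _ hx₀s, real_inner_comm]
    · rw [huv₀]
      filter_upwards [extChartAt_target_mem_nhds (I := 𝓘(ℝ, E)) x₀] with y hy a
      have hz : ξ.symm y ∈ (chartAt E x₀).source := by
        simpa [hξ] using (extChartAt 𝓘(ℝ, E) x₀).map_target hy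
      rw [← (extChartAt 𝓘(ℝ, E) x₀).right_inv hy, ← tangentCoord_constantField hz a]
      refine (congrArg _ (hK _ hz _)).trans ((hK _ hz _).trans ?_)
      rw [hJ.1.map_map]
      exact map_neg _ _
    · intro a b
      rw [huv₀, ← tangentCoord_constantField hx₀s a, ← tangentCoord_constantField hx₀s b,
        hK _ hx₀s, hK _ hx₀s, hG _ hx₀s, hG _ hx₀s, hJ.1.inner_map_map]
    · have : ∀ w : E₂, ∀ᶠ v in 𝓝 v₀,
          G (u v) (fderiv ℝ u v (0, w)) (fderiv ℝ u v (ζ, 0)) = 0 := by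
        intro w
        filter_upwards [hgood] with v hv
        rw [hright v hv, hleft v hv]
        exact (hG _ hv.2.2.1 _ _).trans (inner_mfderiv_right_left hf hφ _ _ _ _)
      rintro w (rfl | rfl) <;> exact this _
    · have : ∀ w : E₂, ∀ᶠ v in 𝓝 v₀,
          G (u v) (K (u v) (fderiv ℝ u v (0, w))) (fderiv ℝ u v (ζ, 0)) = 0 := by
        intro w
        filter_upwards [hgood] with v hv
        obtain ⟨y, hy⟩ := hJmem (η₁.symm v.1) (η₂.symm v.2) (constantField q₀ w (η₂.symm v.2))
        rw [hright v hv, hleft v hv]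
        have h1 := hK _ hv.2.2.1 (mfderiv 𝓘(ℝ, E₂) 𝓘(ℝ, E)
          (fun q ↦ φ (η₁.symm v.1, q)) (η₂.symm v.2) (constantField q₀ w (η₂.symm v.2)))
        rw [← hy] at h1
        refine (congrArg (fun a ↦ G (u v) a _) h1).trans ?_
        exact (hG _ hv.2.2.1 _ _).trans (inner_mfderiv_right_left hf hφ _ _ _ _)
      rintro w (rfl | rfl) <;> exact this _
    · have : ∀ w : E₂, HasDerivAt (fun s : ℝ ↦ G (u (v₀ + s • (ζ, 0)))
          (fderiv ℝ u (v₀ + s • (ζ, 0)) (0, w)) (fderiv ℝ u (v₀ + s • (ζ, 0)) (0, w)))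
          (2 * (fderiv ℝ (f ∘ η₁.symm) (η₁ p₀) ζ / f p₀) *
            G (u v₀) (fderiv ℝ u v₀ (0, w)) (fderiv ℝ u v₀ (0, w))) 0 := by
        intro w
        have hline : ContinuousAt (fun s : ℝ ↦ v₀ + s • ((ζ, 0) : E₁ × E₂)) 0 := by fun_prop
        have hev : ∀ᶠ s in 𝓝 (0 : ℝ), G (u (v₀ + s • (ζ, 0)))
            (fderiv ℝ u (v₀ + s • (ζ, 0)) (0, w)) (fderiv ℝ u (v₀ + s • (ζ, 0)) (0, w)) =
            (f ∘ η₁.symm) (η₁ p₀ + s • ζ) ^ 2 * C w v₀.2 := by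
          have h0 : Tendsto (fun s : ℝ ↦ v₀ + s • ((ζ, 0) : E₁ × E₂)) (𝓝 0) (𝓝 v₀) := by
            simpa [ContinuousAt] using hline
          filter_upwards [h0.eventually hgood] with s hs
          rw [hnorm _ hs]
          simp [hv₀]
        have hl : HasDerivAt (fun s : ℝ ↦ η₁ p₀ + s • ζ) ζ 0 := by
          simpa using ((hasDerivAt_id (0 : ℝ)).smul_const ζ).const_add (η₁ p₀)
        have hF : HasFDerivAt (f ∘ η₁.symm) (fderiv ℝ (f ∘ η₁.symm) (η₁ p₀))
            (η₁ p₀ + (0 : ℝ) • ζ) := by simpa using hfd.hasFDerivAt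
        have h1 := ((HasFDerivAt.comp_hasDerivAt (0 : ℝ) hF hl).pow 2).mul_const (C w v₀.2)
        refine (h1.congr_of_eventuallyEq hev).congr_deriv ?_
        rw [hnorm v₀ hv₀good]
        simp [hv₀, hp₀]
        field_simp
      rintro w (rfl | rfl) <;> exact this _
  have hfm : MDifferentiableAt 𝓘(ℝ, E₁) 𝓘(ℝ, ℝ) f p₀ :=
    hf.contMDiff.mdifferentiableAt (by simp)
  ext ζ
  exact (mvfderiv_eq_fderiv_extChartAt hfm ζ).trans (main ζ)

section ScaledMetric

variable {E : Type*} [NormedAddCommGroup E] [NormedSpace ℝ E]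
  {N : Type*} [TopologicalSpace N] [ChartedSpace E N] [IsManifold 𝓘(ℝ, E) ∞ N]
  [RiemannianBundle (fun q : N ↦ TangentSpace 𝓘(ℝ, E) q)]
  [IsContMDiffRiemannianBundle 𝓘(ℝ, E) ∞ E (fun q : N ↦ TangentSpace 𝓘(ℝ, E) q)]

set_option synthInstance.maxHeartbeats 400000 in
/-- A positive multiple of a Riemannian metric is a Riemannian metric. -/
lemma exists_contMDiffRiemannianMetric_smul {c : ℝ} (hc : 0 < c) :
    ∃ h : ContMDiffRiemannianMetric 𝓘(ℝ, E) ∞ E (fun q : N ↦ TangentSpace 𝓘(ℝ, E) q),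
      ∀ (q : N) (v w : TangentSpace 𝓘(ℝ, E) q), h.inner q v w = c * inner ℝ v w := by
  obtain ⟨g, hg, hgi⟩ := IsContMDiffRiemannianBundle.exists_contMDiff (IB := 𝓘(ℝ, E)) (n := ∞)
    (F := E) (E := fun q : N ↦ TangentSpace 𝓘(ℝ, E) q)
  refine ⟨⟨fun q ↦ c • g q, fun q v w ↦ ?_, fun q v hv ↦ ?_, fun q ↦ ?_, ?_⟩, fun q v w ↦ ?_⟩
  · simp [← hgi, real_inner_comm]
  · simp only [smul_apply, ← hgi, smul_eq_mul]
    have := real_inner_self_pos.2 hv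
    positivity
  · refine (NormedSpace.isVonNBounded_ball ℝ (TangentSpace 𝓘(ℝ, E) q) (√c)⁻¹).subset ?_
    intro v hv
    have hv' : c * ‖v‖ ^ 2 < 1 := by
      simpa only [Set.mem_ofPred_eq, smul_apply, ← hgi, smul_eq_mul,
        real_inner_self_eq_norm_sq] using hv
    rw [mem_ball_zero_iff, ← one_div, lt_div_iff₀ (Real.sqrt_pos.2 hc)]
    refine lt_of_pow_lt_pow_left₀ 2 zero_le_one ?_
    rw [mul_pow, Real.sq_sqrt hc.le, one_pow]
    linarith
  · intro q
    have h := (contMDiffAt_hom_bundle _).1 (hg q)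
    refine (contMDiffAt_hom_bundle _).2 ⟨h.1, ?_⟩
    refine (contMDiffAt_const (I' := 𝓘(ℝ, ℝ)) (c := c)).smul h.2 |>.congr_of_eventuallyEq ?_
    refine Filter.Eventually.of_forall fun z ↦ ?_
    ext a b
    simp [ContinuousLinearMap.inCoordinates]
  · simp [hgi]

end ScaledMetric

end NearlyKaehler

end

/-- Let `Mbar` be a nearly Kaehler manifold and `φ : Nθ × NT → Mbar` an isometric immersion of a
warped product `Nθ ×_f NT` such that all leaves `{p} × NT` are holomorphic and all leaves
`Nθ × {q}` are proper slant submanifolds of `Mbar`. Then `f` is constant, and `Nθ × NT` is a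
Riemannian product of `Nθ` and of `NT` with its metric rescaled by the constant `f²`. -/
theorem theorem3p1
    {E : Type*} [NormedAddCommGroup E] [NormedSpace ℝ E] [FiniteDimensional ℝ E]
    {Mbar : Type*} [TopologicalSpace Mbar] [ChartedSpace E Mbar] [IsManifold 𝓘(ℝ, E) ∞ Mbar]
    [RiemannianBundle (fun x : Mbar ↦ TangentSpace 𝓘(ℝ, E) x)]
    [IsContMDiffRiemannianBundle 𝓘(ℝ, E) ∞ E (fun x : Mbar ↦ TangentSpace 𝓘(ℝ, E) x)]
    (J : ∀ x : Mbar, TangentSpace 𝓘(ℝ, E) x →L[ℝ] TangentSpace 𝓘(ℝ, E) x)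
    (hJ : NearlyKaehler.IsNearlyKaehler 𝓘(ℝ, E) J)
    {E₁ : Type*} [NormedAddCommGroup E₁] [NormedSpace ℝ E₁] [FiniteDimensional ℝ E₁]
    {Nθ : Type*} [TopologicalSpace Nθ] [ConnectedSpace Nθ] [ChartedSpace E₁ Nθ]
    [IsManifold 𝓘(ℝ, E₁) ∞ Nθ]
    [RiemannianBundle (fun p : Nθ ↦ TangentSpace 𝓘(ℝ, E₁) p)]
    [IsContMDiffRiemannianBundle 𝓘(ℝ, E₁) ∞ E₁ (fun p : Nθ ↦ TangentSpace 𝓘(ℝ, E₁) p)]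
    {E₂ : Type*} [NormedAddCommGroup E₂] [NormedSpace ℝ E₂] [FiniteDimensional ℝ E₂]
    [Nontrivial E₂]
    {NT : Type*} [TopologicalSpace NT] [Nonempty NT] [ChartedSpace E₂ NT]
    [IsManifold 𝓘(ℝ, E₂) ∞ NT]
    [RiemannianBundle (fun q : NT ↦ TangentSpace 𝓘(ℝ, E₂) q)]
    [IsContMDiffRiemannianBundle 𝓘(ℝ, E₂) ∞ E₂ (fun q : NT ↦ TangentSpace 𝓘(ℝ, E₂) q)]
    [RiemannianBundle (fun x : Nθ × NT ↦ TangentSpace (𝓘(ℝ, E₁).prod 𝓘(ℝ, E₂)) x)]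
    [IsContMDiffRiemannianBundle (𝓘(ℝ, E₁).prod 𝓘(ℝ, E₂)) ∞ (E₁ × E₂)
      (fun x : Nθ × NT ↦ TangentSpace (𝓘(ℝ, E₁).prod 𝓘(ℝ, E₂)) x)]
    (f : Nθ → ℝ)
    (hf : NearlyKaehler.IsWarpedProduct 𝓘(ℝ, E₁) (N₁ := Nθ) 𝓘(ℝ, E₂) (N₂ := NT) f)
    (φ : Nθ × NT → Mbar)
    (hφ : NearlyKaehler.IsIsometricImmersion (𝓘(ℝ, E₁).prod 𝓘(ℝ, E₂)) 𝓘(ℝ, E) φ)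
    (hslant : ∀ q : NT,
      NearlyKaehler.IsProperSlantSubmanifold 𝓘(ℝ, E₁) 𝓘(ℝ, E) J (fun p : Nθ ↦ φ (p, q)))
    (hhol : ∀ p : Nθ,
      NearlyKaehler.IsHolomorphicSubmanifold 𝓘(ℝ, E₂) 𝓘(ℝ, E) J (fun q : NT ↦ φ (p, q))) :
    ∃ c : ℝ, 0 < c ∧ (∀ p : Nθ, f p = c) ∧
      ∃ h : ContMDiffRiemannianMetric 𝓘(ℝ, E₂) ∞ E₂ (fun q : NT ↦ TangentSpace 𝓘(ℝ, E₂) q),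
        (∀ (q : NT) (v w : TangentSpace 𝓘(ℝ, E₂) q), h.inner q v w = c ^ 2 * inner ℝ v w) ∧
        NearlyKaehler.IsRiemannianProduct 𝓘(ℝ, E₁) (N₁ := Nθ) 𝓘(ℝ, E₂) (N₂ := NT) h := by
  obtain ⟨q₀⟩ := ‹Nonempty NT›
  have hloc := NearlyKaehler.isLocallyConstant_of_mfderiv_eq_zero
    (hf.contMDiff.mdifferentiable (by simp))
    (fun p ↦ NearlyKaehler.mfderiv_warping_eq_zero hJ hf hφ hhol p q₀)
  obtain ⟨p₀⟩ := (inferInstance : Nonempty Nθ)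
  have hconst : ∀ p, f p = f p₀ := fun p ↦ hloc.apply_eq_of_preconnectedSpace p p₀
  have hpos := hf.pos p₀
  obtain ⟨h, hh⟩ := NearlyKaehler.exists_contMDiffRiemannianMetric_smul (N := NT) (E := E₂)
    (pow_pos hpos 2)
  refine ⟨f p₀, hpos, hconst, h, hh, fun x v w ↦ ?_⟩
  rw [hf.inner_eq, hconst, hh]
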